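/- **Theorem.** Let $p\ge 5$ be a prime, let $\mathbb{Z}_p$ be the ring of $p$-adic integers, and let $a\in\mathbb{Z}_p$ be such that its least non-negative residue $\langle a\rangle_p$ (the integer $r\in\{0,1,\dots,p-1\}$ with $a\equiv r \pmod p$) is even. Then $$\sum_{k=0}^{p-1}\frac{(-a)_k\,(a+1)_k}{(1)_k}\cdot\frac{(1/2)^k}{k!}\;\equiv\;(-1)^{\frac{p+1}{2}}\,\Gamma_p\!\left(\tfrac12\right)\Gamma_p\!\left(-\tfrac a2\right)\Gamma_p\!\left(\tfrac{a+1}{2}\right)\pmod{p^2},$$ i.e. the difference of the two sides lies in $p^2\mathbb{Z}_p$. The left-hand side is the truncated hypergeometric series ${}_2F_1\!\left(-a,\,a+1;\,1;\,\tfrac12\right)_{p-1}$. Here $(x)_0=1$ and $(x)_k=x(x+1)\cdots(x+k-1)$ for $k\ge1$, and $\Gamma_p:\mathbb{Z}_p\to\mathbb{Z}_p$ is Morita's $p$-adic Gamma function $$\Gamma_p(x)=\lim_{m\to x}(-1)^m\prod_{\substack{0<k<m\\ \gcd(k,p)=1}}k,$$ the limit being taken over non-negative integers $m$ tending $p$-adically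 to $x$. -/

import Mathlib

open Filter Topology

/-- The truncated hypergeometric series
`∑_{k=0}^{n} ((a₁)_k ⋯ (a_r)_k) / ((b₁)_k ⋯ (b_s)_k) * z^k / k!`,
where `(a)_k = a (a+1) ⋯ (a+k-1)` is the rising factorial. -/
noncomputable def truncHyp {K : Type*} [Field K] (as bs : List K) (z : K) (n : ℕ) : K :=
  ∑ k ∈ Finset.range (n + 1),
    (as.map fun a => (ascPochhammer K k).eval a).prod /
        (bs.map fun b => (ascPochhammer K k).eval b).prod *
      (z ^ k / (k.factorial : K))

/-- `(-1)^m ∏_{0 < k < m, (k,p) = 1} k`. -/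
def moritaProd (p m : ℕ) : ℤ :=
  (-1) ^ m * ∏ k ∈ (Finset.Ioo 0 m).filter (fun k => Nat.Coprime k p), (k : ℤ)

/-- Morita's `p`-adic Gamma function on `ℤ_[p]` (`p` an odd prime): the limit of
`(-1)^m ∏_{0 < k < m, (k,p) = 1} k` as the natural number `m` tends `p`-adically to `x`. -/
noncomputable def padicGamma (p : ℕ) [Fact p.Prime] (x : ℤ_[p]) : ℤ_[p] :=
  limUnder (comap (Nat.cast : ℕ → ℤ_[p]) (𝓝 x)) (fun m : ℕ => (moritaProd p m : ℤ_[p]))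

/-- `x / 2` for a `p`-adic integer `x`, where `p` is odd. -/
noncomputable def padicHalf (p : ℕ) [Fact p.Prime] (x : ℤ_[p]) : ℤ_[p] :=
  x * Ring.inverse 2

/-- `padicHalf p x` is half of `x`. -/
theorem two_mul_padicHalf (p : ℕ) [Fact p.Prime] (hp : p ≠ 2) (x : ℤ_[p]) :
    2 * padicHalf p x = x := by
  have h : IsUnit (2 : ℤ_[p]) := by
    rw [PadicInt.isUnit_iff]
    have h2 : ‖((2 : ℕ) : ℤ_[p])‖ = 1 :=
      PadicInt.norm_natCast_eq_one_iff.2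
        ((Nat.coprime_primes Fact.out Nat.prime_two).2 hp)
    exact_mod_cast h2
  rw [padicHalf, mul_left_comm, Ring.mul_inverse_cancel _ h, mul_one]

theorem prod_units_zmod_prime_pow (p : ℕ) [Fact p.Prime] (hp : p ≠ 2) (N : ℕ) (hN : N ≠ 0) :
    ∏ u : (ZMod (p ^ N))ˣ, u = -1 := by
  classical
  have hpp : p.Prime := Fact.out
  have := ZMod.isCyclic_units_of_prime_pow p hpp hp N
  have hne : (1 : (ZMod (p ^ N))ˣ) ≠ -1 := by
    intro h
    have h1 : ((2 : ℕ) : ZMod (p ^ N)) = 0 := by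
      have := congrArg Units.val h
      push_cast at this ⊢
      linear_combination this
    rw [ZMod.natCast_eq_zero_iff] at h1
    exact hp ((Nat.prime_dvd_prime_iff_eq hpp Nat.prime_two).1 ((dvd_pow_self p hN).trans h1))
  have hcard := IsCyclic.card_pow_eq_one_le (α := (ZMod (p ^ N))ˣ) (n := 2) (by norm_num)
  have hset : ({1, -1} : Finset (ZMod (p ^ N))ˣ) =
      Finset.univ.filter (fun a : (ZMod (p ^ N))ˣ => a ^ 2 = 1) := by
    apply Finset.eq_of_subset_of_card_le
    · intro a ha
      simp only [Finset.mem_insert, Finset.mem_singleton] at ha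
      rcases ha with rfl | rfl <;> simp
    · rw [Finset.card_pair hne]
      exact hcard
  have hsq : ∀ a : (ZMod (p ^ N))ˣ, a⁻¹ = a → a = 1 ∨ a = -1 := by
    intro a ha
    have : a ∈ ({1, -1} : Finset (ZMod (p ^ N))ˣ) := by
      rw [hset, Finset.mem_filter]
      refine ⟨Finset.mem_univ _, ?_⟩
      nth_rewrite 1 [sq, ← ha]
      simp
    simpa using this
  have hprod : ∏ u ∈ (Finset.univ.erase (-1 : (ZMod (p ^ N))ˣ)), u = 1 := by
    refine Finset.prod_involution (fun u _ => u⁻¹) (by simp) ?_ ?_ (by simp)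
    · intro a ha h1 h2
      rcases hsq a h2 with h | h
      · exact h1 h
      · simp [h] at ha
    · intro a ha
      simp only [Finset.mem_erase, Finset.mem_univ, and_true] at ha ⊢
      intro h
      apply ha
      rw [← inv_inv a, h]
      simp
  rw [← Finset.mul_prod_erase _ _ (Finset.mem_univ (-1 : (ZMod (p ^ N))ˣ)), hprod, mul_one]

theorem moritaProd_eq (p m : ℕ) (hp : p.Prime) :
    moritaProd p m =
      (-1) ^ m * ∏ k ∈ Finset.range m, if Nat.Coprime k p then (k : ℤ) else 1 := by
  rw [moritaProd, ← Finset.prod_filter]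
  congr 2
  ext k
  simp only [Finset.mem_filter, Finset.mem_Ioo, Finset.mem_range]
  refine ⟨fun h => ⟨h.1.2, h.2⟩, fun h => ⟨⟨Nat.pos_of_ne_zero ?_, h.1⟩, h.2⟩⟩
  rintro rfl
  exact hp.one_lt.ne' (by simpa using h.2)

theorem moritaProd_add (p : ℕ) [Fact p.Prime] (hp : p ≠ 2) (N : ℕ) (hN : N ≠ 0) (m : ℕ) :
    (moritaProd p (m + p ^ N) : ZMod (p ^ N)) = moritaProd p m := by
  classical
  have hpp : p.Prime := Fact.out
  have : NeZero (p ^ N) := ⟨pow_ne_zero _ hpp.ne_zero⟩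
  have key : ∏ k ∈ Finset.range (p ^ N),
      (if Nat.Coprime k p then (k : ZMod (p ^ N)) else 1) = -1 := by
    have h1 : ∏ k ∈ Finset.range (p ^ N),
        (if Nat.Coprime k p then (k : ZMod (p ^ N)) else 1) =
        ∏ x : ZMod (p ^ N), if IsUnit x then x else 1 := by
      refine Finset.prod_bij (fun k _ => (k : ZMod (p ^ N))) (by simp) ?_ ?_ ?_
      · intro a ha b hb h
        rw [ZMod.natCast_eq_natCast_iff'] at h
        rwa [Nat.mod_eq_of_lt (Finset.mem_range.1 ha),
          Nat.mod_eq_of_lt (Finset.mem_range.1 hb)] at h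
      · intro x _
        exact ⟨x.val, Finset.mem_range.2 (ZMod.val_lt x), ZMod.natCast_zmod_val x⟩
      · intro a _
        simp only [ZMod.isUnit_iff_coprime,
          Nat.coprime_pow_right_iff (Nat.pos_of_ne_zero hN)]
    rw [h1, ← Finset.prod_filter]
    have h2 : ∏ x ∈ Finset.univ.filter (fun x : ZMod (p ^ N) => IsUnit x), x =
        ∏ u : (ZMod (p ^ N))ˣ, (u : ZMod (p ^ N)) := by
      symm
      refine Finset.prod_bij (fun u _ => (u : ZMod (p ^ N))) (by simp) ?_ ?_ (by simp)
      · intro a _ b _ h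
        exact Units.ext h
      · intro x hx
        obtain ⟨u, rfl⟩ := (Finset.mem_filter.1 hx).2
        exact ⟨u, Finset.mem_univ _, rfl⟩
    rw [h2, ← Units.coe_prod, prod_units_zmod_prime_pow p hp N hN]
    simp
  have shift : ∀ m : ℕ, ∏ k ∈ Finset.range (m + p ^ N),
      (if Nat.Coprime k p then (k : ZMod (p ^ N)) else 1) =
      -∏ k ∈ Finset.range m, (if Nat.Coprime k p then (k : ZMod (p ^ N)) else 1) := by
    intro m
    induction m with
    | zero => simp [key]
    | succ m ih =>
      rw [Nat.add_right_comm, Finset.prod_range_succ, ih, Finset.prod_range_succ]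
      have hc : Nat.Coprime (m + p ^ N) p ↔ Nat.Coprime m p := by
        obtain ⟨M, rfl⟩ := Nat.exists_eq_succ_of_ne_zero hN
        rw [pow_succ]
        simp
      have hz : ((p : ZMod (p ^ N)) ^ N) = 0 := by
        exact_mod_cast ZMod.natCast_self (p ^ N)
      simp only [hc, Nat.cast_add, Nat.cast_pow, hz, add_zero, neg_mul]
  have hodd : Odd (p ^ N) := (hpp.odd_of_ne_two hp).pow
  rw [moritaProd_eq _ _ hpp, moritaProd_eq _ _ hpp]
  push_cast
  rw [shift, pow_add, hodd.neg_one_pow]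
  ring

theorem moritaProd_congr (p : ℕ) [Fact p.Prime] (hp : p ≠ 2) (N : ℕ) (hN : N ≠ 0) (m n : ℕ)
    (h : m ≡ n [MOD p ^ N]) :
    (moritaProd p m : ZMod (p ^ N)) = moritaProd p n := by
  have aux : ∀ m k : ℕ,
      (moritaProd p (m + p ^ N * k) : ZMod (p ^ N)) = moritaProd p m := by
    intro m k
    induction k with
    | zero => simp
    | succ k ih => rw [mul_add, mul_one, ← add_assoc, moritaProd_add p hp N hN, ih]
  rw [← Nat.mod_add_div m (p ^ N), ← Nat.mod_add_div n (p ^ N), aux, aux, h]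

/-- The limit defining the `p`-adic Gamma function exists. -/
theorem tendsto_padicGamma (p : ℕ) [Fact p.Prime] (hp : p ≠ 2) (x : ℤ_[p]) :
    Tendsto (fun m : ℕ => (moritaProd p m : ℤ_[p]))
      (comap (Nat.cast : ℕ → ℤ_[p]) (𝓝 x)) (𝓝 (padicGamma p x)) := by
  have hne : (comap (Nat.cast : ℕ → ℤ_[p]) (𝓝 x)).NeBot :=
    comap_neBot fun _ ht => PadicInt.denseRange_natCast.mem_nhds ht
  refine tendsto_nhds_limUnder (cauchy_map_iff_exists_tendsto.1 ?_)
  rw [Metric.cauchy_iff]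
  refine ⟨hne.map _, fun ε hε => ?_⟩
  obtain ⟨N, hN⟩ := PadicInt.exists_pow_neg_lt p hε
  have hN' : (p : ℝ) ^ (-((N + 1 : ℕ) : ℤ)) < ε := by
    refine lt_of_le_of_lt (zpow_le_zpow_right₀ ?_ ?_) hN
    · exact_mod_cast (Fact.out : p.Prime).one_lt.le
    · push_cast; linarith
  have hp0 : (0 : ℝ) < p := by exact_mod_cast (Fact.out : p.Prime).pos
  have key : ∀ m : ℕ, (∀ n : ℕ,
      ‖(m : ℤ_[p]) - n‖ ≤ (p : ℝ) ^ (-((N + 1 : ℕ) : ℤ)) →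
      ‖(moritaProd p m : ℤ_[p]) - moritaProd p n‖ ≤ (p : ℝ) ^ (-((N + 1 : ℕ) : ℤ))) := by
    intro m n h
    have h1 : m ≡ n [MOD p ^ (N + 1)] := by
      have h2 : ‖(((m : ℤ) - n : ℤ) : ℤ_[p])‖ ≤ (p : ℝ) ^ (-((N + 1 : ℕ) : ℤ)) := by
        push_cast at h ⊢; exact h
      rw [PadicInt.norm_int_le_pow_iff_dvd] at h2
      rw [← Int.natCast_modEq_iff]
      exact (Int.modEq_iff_dvd.2 (by exact_mod_cast h2)).symm
    have h3 := moritaProd_congr p hp (N + 1) (Nat.succ_ne_zero N) m n h1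
    rw [ZMod.intCast_eq_intCast_iff_dvd_sub] at h3
    have h4 : ‖((moritaProd p n - moritaProd p m : ℤ) : ℤ_[p])‖ ≤
        (p : ℝ) ^ (-((N + 1 : ℕ) : ℤ)) := by
      rw [PadicInt.norm_int_le_pow_iff_dvd]
      exact_mod_cast h3
    rw [norm_sub_rev]
    push_cast at h4 ⊢
    exact h4
  have hball : Metric.ball x ((p : ℝ) ^ (-((N + 1 : ℕ) : ℤ))) ∈ 𝓝 x :=
    Metric.ball_mem_nhds _ (zpow_pos hp0 _)
  refine ⟨_, image_mem_map (preimage_mem_comap hball), ?_⟩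
  rintro _ ⟨m, hm, rfl⟩ _ ⟨n, hn, rfl⟩
  rw [dist_eq_norm]
  refine (key m n ?_).trans_lt hN'
  rw [← dist_eq_norm]
  refine (IsUltrametricDist.dist_triangle_max _ x _).trans (max_le (le_of_lt hm) ?_)
  rw [dist_comm]
  exact le_of_lt hn

/-!
Modulo `p ^ 2` both sides of the congruence are affine functions of `t` on the residue class
`a = r + p t`, so two values of `t` that differ by a unit decide it. For `t = 0` the argument is
the even number `r < p`, and for `t = -1` it is `-1 - (p - 1 - r)`; both sides are invariant under
`a ↦ -1 - a`, so this is again an even natural number below `p`. For `a = 2m < p` the series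
terminates and is the value at `1 / 2` of a shifted Legendre polynomial, which Rodrigues' formula
gives as `(-1) ^ m * centralBinom m / 4 ^ m` (`aeval_half_shiftedLegendre`). The Gamma side has the
same value by the functional equation (`gammaMod_neg_mul_gammaMod_add_half`) and
`Γ_p(1 / 2) ^ 2 = (-1) ^ ((p + 1) / 2)` (`gammaMod_half_sq`, from the reflection formula).

The series is affine in `t` because it is a polynomial with `p`-integral coefficients. For `Γ_p`
(`isAffineMod_gammaMod`), the defining product splits into blocks of `p` consecutive integers, and
the product over a full block of units is the same for all blocks modulo `p ^ 2` (`prod_block`). By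
Wilson's theorem it is minus a number `1 + p w`, and `(1 + p w) ^ s` is affine in `s`.

All computations take place in `ZMod (p ^ 2)`, where `Γ_p` becomes the function `gammaMod`.
-/

/-! ### The Legendre value at the midpoint -/

open Polynomial in
theorem shiftedLegendre_eq_hasseDeriv (n : ℕ) :
    shiftedLegendre n = hasseDeriv n ((X : ℤ[X]) ^ n * (1 - X) ^ n) := by
  have h0 : ((n.factorial : ℕ) : ℤ[X]) ≠ 0 := by exact_mod_cast n.factorial_ne_zero
  apply mul_left_cancel₀ h0
  rw [factorial_mul_shiftedLegendre_eq, ← factorial_smul_hasseDeriv]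
  simp

open Polynomial in
/-- The value at `1 / 2` is the `2m`-th Taylor coefficient of `(X (1 - X)) ^ (2m)` at that point,
where `X (1 - X)` becomes `1 / 4 - Y ^ 2`. -/
theorem aeval_half_shiftedLegendre {R : Type*} [CommRing R] {h : R} (hh : 2 * h = 1) (m : ℕ) :
    aeval h (shiftedLegendre (2 * m)) = (-1) ^ m * m.centralBinom * h ^ (2 * m) := by
  have hmap : (shiftedLegendre (2 * m)).map (Int.castRingHom R) =
      hasseDeriv (2 * m) (X ^ (2 * m) * (1 - X) ^ (2 * m) : R[X]) := by
    have : (X ^ (2 * m) * (1 - X) ^ (2 * m) : R[X]) =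
        ((X : ℤ[X]) ^ (2 * m) * (1 - X) ^ (2 * m)).map (Int.castRingHom R) := by simp
    rw [shiftedLegendre_eq_hasseDeriv, this]
    ext k
    simp only [coeff_map, hasseDeriv_coeff, map_mul, map_natCast]
  have htaylor : taylor h (X ^ (2 * m) * (1 - X) ^ (2 * m) : R[X]) =
      expand R 2 ((X + C (-h ^ 2)) ^ (2 * m)) := by
    have hC : (2 : R[X]) * C h = 1 := by
      rw [← C_1, ← hh, C_mul]; rfl
    have h1 : taylor h (X * (1 - X) : R[X]) = -(X ^ 2 + C (-h ^ 2)) := by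
      simp only [taylor_mul, map_sub, taylor_X, taylor_one, C_neg, C_pow, C_1]
      linear_combination (-X - C h) * hC
    rw [← mul_pow, taylor_pow, h1, (even_two_mul m).neg_pow]
    simp
  rw [aeval_def, ← eval_map, algebraMap_int_eq, hmap, ← taylor_coeff, htaylor,
    mul_comm 2 m, coeff_expand_mul (by norm_num), coeff_X_add_C_pow, Nat.centralBinom]
  rw [show m * 2 - m = m by omega, neg_pow, ← pow_mul, mul_comm 2 m]
  ring

/-! ### The truncated series in a ring where small factorials are invertible -/

/-- The series `₂F₁(-x, x + 1; 1; h)` truncated to `p` terms, in a commutative ring, where `u k`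
stands for the inverse of `k!`. -/
noncomputable def legendreSum {R : Type*} [CommRing R] (p : ℕ) (u : ℕ → R) (h x : R) : R :=
  ∑ k ∈ Finset.range p,
    (ascPochhammer R k).eval (-x) * (ascPochhammer R k).eval (x + 1) * u k ^ 2 * h ^ k

theorem legendreSum_reflect {R : Type*} [CommRing R] (p : ℕ) (u : ℕ → R) (h x : R) :
    legendreSum p u h (-1 - x) = legendreSum p u h x := by
  refine Finset.sum_congr rfl fun k _ => ?_
  rw [show -(-1 - x) = x + 1 by ring, show -1 - x + 1 = -x by ring]
  ring

theorem legendreSum_two_mul {R : Type*} [CommRing R] {p : ℕ} {u : ℕ → R}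
    (hu : ∀ k < p, (k.factorial : R) * u k = 1) {h : R} (hh : 2 * h = 1) {m : ℕ}
    (hm : 2 * m < p) :
    legendreSum p u h ((2 * m : ℕ) : R) = (-1) ^ m * m.centralBinom * h ^ (2 * m) := by
  rw [← aeval_half_shiftedLegendre hh m, Polynomial.aeval_eq_sum_range'
    (n := p) (by rwa [Polynomial.natDegree_shiftedLegendre])]
  refine Finset.sum_congr rfl fun k hk => ?_
  have hk := hu k (Finset.mem_range.1 hk)
  have h1 : (ascPochhammer R k).eval (((2 * m : ℕ) : R) + 1) =
      (k.factorial : R) * (2 * m + k).choose (2 * m) := by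
    rw [← Nat.cast_succ, ← Nat.cast_ascFactorial, Nat.ascFactorial_eq_factorial_mul_choose,
      Nat.choose_symm_add]
    push_cast; ring
  rw [ascPochhammer_eval_neg_eq_descPochhammer, descPochhammer_eval_eq_descFactorial,
    Nat.descFactorial_eq_factorial_mul_choose, h1, Polynomial.coeff_shiftedLegendre, zsmul_eq_mul]
  push_cast
  linear_combination ((-1) ^ k * ((2 * m).choose k : R) * ((2 * m + k).choose (2 * m) : R) * h ^ k)
    * (k.factorial * u k + 1) * hk

/-! ### Functions that are affine modulo the square of a prime -/

/-- `f` is affine in `t` with slope divisible by `π`. When `π ^ 2 = 0` these functions form a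
ring, which contains `t ↦ q (x + π t)` for every polynomial `q`. -/
def IsAffineMod {R : Type*} [CommRing R] (π : R) (f : R → R) : Prop :=
  ∃ c d, ∀ t, f t = c + π * d * t

namespace IsAffineMod

variable {R : Type*} [CommRing R] {π : R}

theorem const (c : R) : IsAffineMod π fun _ => c := ⟨c, 0, by simp⟩

theorem add_mul (x c : R) : IsAffineMod π fun t => x + π * c * t := ⟨x, c, fun _ => rfl⟩

theorem add {f g : R → R} (hf : IsAffineMod π f) (hg : IsAffineMod π g) :
    IsAffineMod π fun t => f t + g t := by
  obtain ⟨c, d, h⟩ := hf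
  obtain ⟨c', d', h'⟩ := hg
  exact ⟨c + c', d + d', fun t => by simp only [h, h']; ring⟩

theorem mul (hπ : π ^ 2 = 0) {f g : R → R} (hf : IsAffineMod π f) (hg : IsAffineMod π g) :
    IsAffineMod π fun t => f t * g t := by
  obtain ⟨c, d, h⟩ := hf
  obtain ⟨c', d', h'⟩ := hg
  exact ⟨c * c', c * d' + d * c', fun t => by
    simp only [h, h']; linear_combination d * d' * t ^ 2 * hπ⟩

theorem sum {ι : Type*} (s : Finset ι) {f : ι → R → R}
    (hf : ∀ i ∈ s, IsAffineMod π (f i)) : IsAffineMod π fun t => ∑ i ∈ s, f i t := by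
  classical
  induction s using Finset.induction_on with
  | empty => simpa using const 0
  | insert i s hi ih =>
    simp only [Finset.sum_insert hi]
    exact (hf i (by simp)).add (ih fun j hj => hf j (by simp [hj]))

theorem prod (hπ : π ^ 2 = 0) {ι : Type*} (s : Finset ι) {f : ι → R → R}
    (hf : ∀ i ∈ s, IsAffineMod π (f i)) : IsAffineMod π fun t => ∏ i ∈ s, f i t := by
  classical
  induction s using Finset.induction_on with
  | empty => simpa using const 1
  | insert i s hi ih =>
    simp only [Finset.prod_insert hi]
    exact (hf i (by simp)).mul hπ (ih fun j hj => hf j (by simp [hj]))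

theorem comp_add_mul {f : R → R} (hf : IsAffineMod π f) (b c : R) :
    IsAffineMod π fun t => f (b + c * t) := by
  obtain ⟨x, d, h⟩ := hf
  exact ⟨x + π * d * b, d * c, fun t => by simp only [h]; ring⟩

theorem eval_ascPochhammer (hπ : π ^ 2 = 0) {f : R → R} (hf : IsAffineMod π f) (k : ℕ) :
    IsAffineMod π fun t => (ascPochhammer R k).eval (f t) := by
  induction k with
  | zero => simpa using const 1
  | succ k ih =>
    simp only [ascPochhammer_succ_eval]
    exact ih.mul hπ (hf.add (const _))

/-- Two values whose arguments differ by a unit determine such a function. -/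
theorem eq_of_eq {f g : R → R} (hf : IsAffineMod π f) (hg : IsAffineMod π g)
    (h0 : f 0 = g 0) (h1 : f (-1) = g (-1)) (t : R) : f t = g t := by
  obtain ⟨c, d, h⟩ := hf
  obtain ⟨c', d', h'⟩ := hg
  rw [h, h'] at h0 h1 ⊢
  linear_combination (1 + t) * h0 - t * h1

end IsAffineMod

theorem isAffineMod_legendreSum {R : Type*} [CommRing R] {π : R} (hπ : π ^ 2 = 0) (p : ℕ)
    (u : ℕ → R) (h x : R) : IsAffineMod π fun t => legendreSum p u h (x + π * t) := by
  have hx : IsAffineMod π fun t => -(x + π * t) := ⟨-x, -1, fun t => by ring⟩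
  have hx' : IsAffineMod π fun t => x + π * t + 1 := ⟨x + 1, 1, fun t => by ring⟩
  exact .sum _ fun k _ => (((hx.eval_ascPochhammer hπ k).mul hπ
    (hx'.eval_ascPochhammer hπ k)).mul hπ (.const _)).mul hπ (.const _)

/-! ### Reduction of the `p`-adic Gamma function modulo the square of `p` -/

/-- Morita's `p`-adic Gamma function modulo `p ^ 2`, evaluated at the least natural
representative of its argument. -/
def gammaMod (p : ℕ) (x : ZMod (p ^ 2)) : ZMod (p ^ 2) := moritaProd p x.val

theorem eventually_toZModPow_eq {p : ℕ} [Fact p.Prime] (n : ℕ) (x : ℤ_[p]) :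
    ∀ᶠ y in 𝓝 x, PadicInt.toZModPow n y = PadicInt.toZModPow n x := by
  have hp0 : (0 : ℝ) < p := by exact_mod_cast (Fact.out : p.Prime).pos
  filter_upwards [Metric.ball_mem_nhds x (zpow_pos hp0 (-(n : ℤ)))] with y hy
  rw [← sub_eq_zero, ← map_sub, ← RingHom.mem_ker, PadicInt.ker_toZModPow,
    ← PadicInt.norm_le_pow_iff_mem_span_pow, ← dist_eq_norm]
  exact le_of_lt hy

section GammaMod

variable {p : ℕ} [Fact p.Prime]

theorem gammaMod_natCast (hp : p ≠ 2) (m : ℕ) : gammaMod p m = moritaProd p m :=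
  moritaProd_congr p hp 2 two_ne_zero _ _ (by rw [ZMod.val_natCast]; exact Nat.mod_modEq _ _)

theorem toZModPow_padicGamma (hp : p ≠ 2) (x : ℤ_[p]) :
    PadicInt.toZModPow 2 (padicGamma p x) = gammaMod p (PadicInt.toZModPow 2 x) := by
  have : (comap (Nat.cast : ℕ → ℤ_[p]) (𝓝 x)).NeBot :=
    comap_neBot fun _ ht => PadicInt.denseRange_natCast.mem_nhds ht
  obtain ⟨m, hm, hm'⟩ := ((tendsto_padicGamma p hp x).eventually
    (eventually_toZModPow_eq 2 _)).and (tendsto_comap.eventually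
      (eventually_toZModPow_eq 2 x)) |>.exists
  rw [← hm, ← hm', map_intCast, map_natCast, gammaMod_natCast hp]

theorem moritaProd_succ (p n : ℕ) [hp : Fact p.Prime] :
    moritaProd p (n + 1) = (if n.Coprime p then -(n : ℤ) else -1) * moritaProd p n := by
  rw [moritaProd_eq _ _ hp.out, moritaProd_eq _ _ hp.out, Finset.prod_range_succ]
  split_ifs <;> ring

omit [Fact p.Prime] in
theorem isUnit_natCast_zmod_sq {n : ℕ} : IsUnit (n : ZMod (p ^ 2)) ↔ n.Coprime p := by
  rw [ZMod.isUnit_iff_coprime, Nat.coprime_pow_right_iff two_pos]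

theorem gammaMod_add_one_of_isUnit (hp : p ≠ 2) {x : ZMod (p ^ 2)} (hx : IsUnit x) :
    gammaMod p (x + 1) = -x * gammaMod p x := by
  obtain ⟨n, rfl⟩ := ZMod.natCast_zmod_surjective x
  rw [← Nat.cast_succ, gammaMod_natCast hp, gammaMod_natCast hp, Nat.succ_eq_add_one,
    moritaProd_succ, if_pos (isUnit_natCast_zmod_sq.1 hx)]
  push_cast; rfl

theorem gammaMod_add_one_of_not_isUnit (hp : p ≠ 2) {x : ZMod (p ^ 2)} (hx : ¬IsUnit x) :
    gammaMod p (x + 1) = -gammaMod p x := by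
  obtain ⟨n, rfl⟩ := ZMod.natCast_zmod_surjective x
  rw [← Nat.cast_succ, gammaMod_natCast hp, gammaMod_natCast hp, Nat.succ_eq_add_one,
    moritaProd_succ, if_neg (isUnit_natCast_zmod_sq.not.1 hx)]
  push_cast; ring

theorem gammaMod_zero (hp : p ≠ 2) : gammaMod p 0 = 1 := by
  have := gammaMod_natCast (p := p) hp 0
  simpa [moritaProd] using this

theorem coprime_mul_add_succ {i : ℕ} (hi : i + 1 < p) (s : ℕ) :
    (p * s + (i + 1)).Coprime p := by
  rw [Nat.coprime_mul_left_add_left]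
  exact (Nat.coprime_of_lt_prime (Nat.succ_ne_zero i) hi Fact.out).symm

/-! ### The `p`-adic Gamma function is affine on small discs -/

theorem natCast_prime_sq_eq_zero (p : ℕ) : (p : ZMod (p ^ 2)) ^ 2 = 0 := by
  exact_mod_cast ZMod.natCast_self (p ^ 2)

theorem isAffineMod_prod_add {R : Type*} [CommRing R] {π : R} (hπ : π ^ 2 = 0) (b : R) (n : ℕ) :
    IsAffineMod π fun t => ∏ j ∈ Finset.range n, (π * (b + t) + (j + 1)) :=
  .prod hπ _ fun j _ => ⟨π * b + (j + 1), 1, fun t => by ring⟩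

/-- The product over a block of `p - 1` units does not depend on the block: it is affine in `t`
and invariant under `t ↦ -1 - t`. -/
theorem prod_block (hp : p ≠ 2) (t : ZMod (p ^ 2)) :
    ∏ j ∈ Finset.range (p - 1), ((p : ZMod (p ^ 2)) * t + ((j : ZMod (p ^ 2)) + 1)) =
      ((p - 1).factorial : ZMod (p ^ 2)) := by
  have hW0 : ∏ j ∈ Finset.range (p - 1),
      ((p : ZMod (p ^ 2)) * 0 + ((j : ZMod (p ^ 2)) + 1)) =
      ((p - 1).factorial : ZMod (p ^ 2)) := by
    rw [← Finset.prod_range_add_one_eq_factorial]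
    push_cast; simp
  have hreflect : ∀ j ∈ Finset.range (p - 1),
      (p : ZMod (p ^ 2)) * (-1) + (((p - 1 - 1 - j : ℕ) : ZMod (p ^ 2)) + 1) =
      (-1) * ((p : ZMod (p ^ 2)) * 0 + ((j : ZMod (p ^ 2)) + 1)) := by
    intro j hj
    have hj := Finset.mem_range.1 hj
    have := congrArg (Nat.cast : ℕ → ZMod (p ^ 2))
      (show p - 1 - 1 - j + (j + 1 + 1) = p by omega)
    rw [Nat.cast_add] at this
    push_cast at this
    linear_combination this
  have hW1 : ∏ j ∈ Finset.range (p - 1),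
      ((p : ZMod (p ^ 2)) * (-1) + ((j : ZMod (p ^ 2)) + 1)) =
      ((p - 1).factorial : ZMod (p ^ 2)) := by
    rw [← Finset.prod_range_reflect, Finset.prod_congr rfl hreflect, Finset.prod_mul_distrib,
      Finset.prod_const, Finset.card_range,
      ((Fact.out : p.Prime).even_sub_one hp).neg_one_pow, one_mul, hW0]
  have haff := isAffineMod_prod_add (natCast_prime_sq_eq_zero p) 0 (p - 1)
  simp only [zero_add] at haff
  exact haff.eq_of_eq (.const _) hW0 hW1 t

theorem moritaProd_mul_add (hp : p ≠ 2) (s : ℕ) {i : ℕ} (hi : i < p) :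
    (moritaProd p (p * s + (i + 1)) : ZMod (p ^ 2)) =
      (-1) ^ (i + 1) * (∏ j ∈ Finset.range i, ((p : ZMod (p ^ 2)) * (s : ZMod (p ^ 2)) +
        ((j : ZMod (p ^ 2)) + 1))) *
        (-((p - 1).factorial : ZMod (p ^ 2))) ^ s := by
  have hpp : p.Prime := Fact.out
  have step : ∀ s : ℕ, (moritaProd p (p * s + 1) : ZMod (p ^ 2)) =
      -(-((p - 1).factorial : ZMod (p ^ 2))) ^ s → ∀ i < p,
      (moritaProd p (p * s + (i + 1)) : ZMod (p ^ 2)) =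
      (-1) ^ (i + 1) * (∏ j ∈ Finset.range i, ((p : ZMod (p ^ 2)) * (s : ZMod (p ^ 2)) +
        ((j : ZMod (p ^ 2)) + 1))) *
        (-((p - 1).factorial : ZMod (p ^ 2))) ^ s := by
    intro s hs i
    induction i with
    | zero => intro _; simp [hs]
    | succ i ih =>
      intro hi
      rw [← add_assoc, moritaProd_succ, if_pos (coprime_mul_add_succ hi s), Int.cast_mul,
        ih (by omega), Finset.prod_range_succ]
      push_cast; ring
  refine step s ?_ i hi
  induction s with
  | zero =>
    rw [mul_zero, moritaProd_succ, if_neg (by simpa using hpp.ne_one)]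
    simp [moritaProd]
  | succ s ih =>
    have h := step s ih (p - 1) (by have := hpp.pos; omega)
    rw [Nat.sub_add_cancel hpp.one_le, prod_block hp, (hpp.odd_of_ne_two hp).neg_one_pow] at h
    rw [moritaProd_succ, mul_add_one, if_neg (by simp [hpp.ne_one])]
    push_cast
    rw [h]
    ring

theorem exists_neg_factorial_eq (p : ℕ) [Fact p.Prime] :
    ∃ w : ZMod (p ^ 2), -((p - 1).factorial : ZMod (p ^ 2)) = 1 + (p : ZMod (p ^ 2)) * w := by
  obtain ⟨w, hw⟩ : p ∣ (p - 1).factorial + 1 := by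
    rw [← ZMod.natCast_eq_zero_iff]
    push_cast
    rw [ZMod.wilsons_lemma, neg_add_cancel]
  refine ⟨-w, ?_⟩
  have := congrArg (Nat.cast : ℕ → ZMod (p ^ 2)) hw
  push_cast at this
  linear_combination -this

theorem one_add_mul_pow_of_sq_eq_zero {R : Type*} [CommRing R] {π : R} (hπ : π ^ 2 = 0) (w : R)
    (s : ℕ) : (1 + π * w) ^ s = 1 + π * w * s := by
  induction s with
  | zero => simp
  | succ s ih =>
    rw [pow_succ, ih]
    push_cast
    linear_combination w ^ 2 * s * hπ

theorem isAffineMod_gammaMod (hp : p ≠ 2) (x : ZMod (p ^ 2)) :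
    IsAffineMod (p : ZMod (p ^ 2)) fun t => gammaMod p (x + (p : ZMod (p ^ 2)) * t) := by
  have hpp : p.Prime := Fact.out
  have hπ := natCast_prime_sq_eq_zero p
  -- The representative is shifted by `p ^ 2` so that its predecessor is a natural number.
  set s := (x.val + (p ^ 2 - 1)) / p
  set i := (x.val + (p ^ 2 - 1)) % p
  have hx : x = ((p * s + (i + 1) : ℕ) : ZMod (p ^ 2)) := by
    have h1 : p * s + (i + 1) = x.val + p ^ 2 := by
      have : p * s + i = x.val + (p ^ 2 - 1) := Nat.div_add_mod _ p
      have := pow_pos hpp.pos 2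
      omega
    rw [h1]
    push_cast
    rw [hπ, add_zero, ZMod.natCast_zmod_val]
  obtain ⟨w, hw⟩ := exists_neg_factorial_eq p
  have key : (fun t => gammaMod p (x + (p : ZMod (p ^ 2)) * t)) = fun t : ZMod (p ^ 2) =>
      (-1) ^ (i + 1) *
      (∏ j ∈ Finset.range i, ((p : ZMod (p ^ 2)) * ((s : ZMod (p ^ 2)) + t) +
        ((j : ZMod (p ^ 2)) + 1))) *
        (1 + (p : ZMod (p ^ 2)) * w * (s : ZMod (p ^ 2)) + (p : ZMod (p ^ 2)) * w * t) := by
    funext t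
    have hxt : x + (p : ZMod (p ^ 2)) * t = ((p * (s + t.val) + (i + 1) : ℕ) : ZMod (p ^ 2)) := by
      rw [hx]
      push_cast
      rw [ZMod.natCast_zmod_val]
      ring
    rw [hxt, gammaMod_natCast hp, moritaProd_mul_add hp _ (Nat.mod_lt _ hpp.pos), hw,
      one_add_mul_pow_of_sq_eq_zero hπ]
    push_cast
    rw [ZMod.natCast_zmod_val]
    ring
  rw [key]
  exact ((IsAffineMod.const _).mul hπ (isAffineMod_prod_add hπ _ _)).mul hπ (.add_mul _ _)

/-! ### Special values -/

theorem gammaMod_mul_reflect (hp : p ≠ 2) (s : ℕ) {i : ℕ} (hi : i < p) :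
    gammaMod p ((p * s + i : ℕ) + 1) * gammaMod p (-(p * s + i : ℕ)) = (-1) ^ (i + 1) := by
  have hpp : p.Prime := Fact.out
  have hunit : ∀ {y : ZMod (p ^ 2)}, IsUnit y →
      gammaMod p (y + 1) * gammaMod p (-y) = -(gammaMod p y * gammaMod p (1 - y)) := by
    intro y hy
    rw [sub_eq_neg_add, gammaMod_add_one_of_isUnit hp hy, gammaMod_add_one_of_isUnit hp hy.neg]
    ring
  have hnonunit : ∀ {y : ZMod (p ^ 2)}, ¬IsUnit y →
      gammaMod p (y + 1) * gammaMod p (-y) = gammaMod p y * gammaMod p (1 - y) := by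
    intro y hy
    rw [sub_eq_neg_add, gammaMod_add_one_of_not_isUnit hp hy,
      gammaMod_add_one_of_not_isUnit hp (by rwa [IsUnit.neg_iff])]
    ring
  have step : ∀ s : ℕ, gammaMod p ((p * s : ℕ) + 1) * gammaMod p (-(p * s : ℕ)) = -1 →
      ∀ i < p, gammaMod p ((p * s + i : ℕ) + 1) * gammaMod p (-(p * s + i : ℕ)) =
        (-1) ^ (i + 1) := by
    intro s hs i
    induction i with
    | zero => intro _; simpa using hs
    | succ i ih =>
      intro hi
      rw [hunit (isUnit_natCast_zmod_sq.2 (coprime_mul_add_succ hi s)), pow_succ _ (i + 1),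
        ← ih (by omega)]
      push_cast
      ring_nf
  refine step s ?_ i hi
  induction s with
  | zero =>
    rw [mul_zero, hnonunit (by rw [isUnit_natCast_zmod_sq]; simpa using hpp.ne_one)]
    have := gammaMod_add_one_of_not_isUnit hp (p := p) (x := 0)
      (by simpa using (isUnit_natCast_zmod_sq (p := p) (n := 0)).not.2 (by simpa using hpp.ne_one))
    rw [zero_add, gammaMod_zero hp] at this
    simp [this, gammaMod_zero hp]
  | succ s ih =>
    have h := step s ih (p - 1) (by have := hpp.pos; omega)
    rw [hnonunit (by rw [isUnit_natCast_zmod_sq]; simpa using hpp.ne_one)]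
    rw [Nat.sub_add_cancel hpp.one_le, (hpp.odd_of_ne_two hp).neg_one_pow,
      Nat.cast_add _ (p - 1), Nat.cast_sub hpp.one_le] at h
    rw [← h]
    push_cast
    ring_nf

theorem gammaMod_half_sq (hp : p ≠ 2) {h : ZMod (p ^ 2)} (hh : 2 * h = 1) :
    gammaMod p h ^ 2 = (-1) ^ ((p + 1) / 2) := by
  have hpp : p.Prime := Fact.out
  obtain ⟨q, hq⟩ := hpp.odd_of_ne_two hp
  -- `1 / 2` and `(p ^ 2 + 1) / 2 = p q + q + 1` agree modulo `p ^ 2`, where `q = (p - 1) / 2`.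
  have hπ := natCast_prime_sq_eq_zero p
  have hp' : (p : ZMod (p ^ 2)) = 2 * q + 1 := by exact_mod_cast congrArg Nat.cast hq
  have h1 : ((p * q + q : ℕ) : ZMod (p ^ 2)) = -h := by
    push_cast
    linear_combination -(p * q + q : ZMod (p ^ 2)) * hh + h * hπ -
      h * (p + 1) * hp'
  have := gammaMod_mul_reflect hp q (i := q) (by omega)
  rw [h1, neg_neg, show -h + 1 = h by linear_combination -hh, ← sq] at this
  rw [this, show (p + 1) / 2 = q + 1 by omega]

theorem gammaMod_neg_mul_gammaMod_add_half (hp : p ≠ 2) {h : ZMod (p ^ 2)} (hh : 2 * h = 1)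
    {m : ℕ} (hm : 2 * m < p) :
    gammaMod p (-(m : ZMod (p ^ 2))) * gammaMod p ((m : ZMod (p ^ 2)) + h) =
      (-1) ^ m * (m.centralBinom : ZMod (p ^ 2)) * h ^ (2 * m) * gammaMod p h := by
  have hpp : p.Prime := Fact.out
  induction m with
  | zero => simp [gammaMod_zero hp]
  | succ m ih =>
    have hu : ∀ {n : ℕ}, 0 < n → n < p → IsUnit (n : ZMod (p ^ 2)) := fun h0 h1 =>
      isUnit_natCast_zmod_sq.2 (Nat.coprime_of_lt_prime h0.ne' h1 hpp).symm
    have h1 : IsUnit ((m + 1 : ℕ) : ZMod (p ^ 2)) := hu (by omega) (by omega)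
    have h2 : IsUnit ((m : ZMod (p ^ 2)) + h) := by
      have : (m : ZMod (p ^ 2)) + h = h * (2 * m + 1 : ℕ) := by
        push_cast; linear_combination (-m : ZMod (p ^ 2)) * hh
      rw [this]
      exact (IsUnit.of_mul_eq_one_right _ hh).mul (hu (by omega) (by omega))
    have e1 := gammaMod_add_one_of_isUnit hp h1.neg
    have e2 := gammaMod_add_one_of_isUnit hp h2
    have e3 := congrArg (Nat.cast : ℕ → ZMod (p ^ 2)) (Nat.succ_mul_centralBinom_succ m)
    have e4 := ih (by omega)
    rw [show -((m + 1 : ℕ) : ZMod (p ^ 2)) + 1 = -m by push_cast; ring] at e1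
    rw [e1] at e4
    apply h1.mul_left_cancel
    push_cast at e1 e3 e4 ⊢
    rw [show (m : ZMod (p ^ 2)) + 1 + h = m + h + 1 by ring, e2]
    linear_combination (-(m : ZMod (p ^ 2)) - h) * e4 -
      (-1) ^ (m + 1) * h ^ (2 * m) * h ^ 2 * gammaMod p h * e3 +
      (-1) ^ m * h ^ (2 * m) * m.centralBinom * gammaMod p h * (m * (2 * h + 1) + h) * hh

end GammaMod

/-! ### The congruence -/

/-- The congruence in `ZMod (p ^ 2)` for an argument in the residue class of the even number `2m`.
Both sides are affine in `t`; at `t = 0` they have the argument `2m`, and at `t = -1` the argument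
`-1 - (p - 1 - 2m)`, which the symmetry `x ↦ -1 - x` carries to the even number `p - 1 - 2m`. -/
theorem legendreSum_eq_gammaMod {p : ℕ} [Fact p.Prime] (hp : p ≠ 2) {u : ℕ → ZMod (p ^ 2)}
    (hu : ∀ k < p, (k.factorial : ZMod (p ^ 2)) * u k = 1) {h : ZMod (p ^ 2)} (hh : 2 * h = 1)
    {m : ℕ} (hm : 2 * m < p) (t : ZMod (p ^ 2)) :
    legendreSum p u h (((2 * m : ℕ) : ZMod (p ^ 2)) + (p : ZMod (p ^ 2)) * t) =
      (-1) ^ ((p + 1) / 2) * gammaMod p h *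
        (gammaMod p (-(((2 * m : ℕ) : ZMod (p ^ 2)) + (p : ZMod (p ^ 2)) * t) * h) *
        gammaMod p ((((2 * m : ℕ) : ZMod (p ^ 2)) + (p : ZMod (p ^ 2)) * t + 1) * h)) := by
  have hpp : p.Prime := Fact.out
  have hπ := natCast_prime_sq_eq_zero p
  have hεsq : ((-1 : ZMod (p ^ 2)) ^ ((p + 1) / 2)) ^ 2 = 1 := by
    rw [← pow_mul, mul_comm, pow_mul]; simp
  have heven : ∀ n : ℕ, 2 * n < p → legendreSum p u h ((2 * n : ℕ) : ZMod (p ^ 2)) =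
      (-1) ^ ((p + 1) / 2) * gammaMod p h *
        (gammaMod p (-((2 * n : ℕ) : ZMod (p ^ 2)) * h) *
        gammaMod p ((((2 * n : ℕ) : ZMod (p ^ 2)) + 1) * h)) := by
    intro n hn
    rw [show -((2 * n : ℕ) : ZMod (p ^ 2)) * h = -(n : ZMod (p ^ 2)) by
        push_cast; linear_combination -(n : ZMod (p ^ 2)) * hh,
      show (((2 * n : ℕ) : ZMod (p ^ 2)) + 1) * h = n + h by
        push_cast; linear_combination (n : ZMod (p ^ 2)) * hh,
      gammaMod_neg_mul_gammaMod_add_half hp hh hn, legendreSum_two_mul hu hh hn]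
    have hsq := gammaMod_half_sq hp hh
    linear_combination (-((-1) ^ n * (n.centralBinom : ZMod (p ^ 2)) * h ^ (2 * n))) *
      (hεsq + (-1) ^ ((p + 1) / 2) * hsq)
  refine (isAffineMod_legendreSum hπ p u h _).eq_of_eq (g := fun t =>
      (-1) ^ ((p + 1) / 2) * gammaMod p h *
        (gammaMod p (-(((2 * m : ℕ) : ZMod (p ^ 2)) + (p : ZMod (p ^ 2)) * t) * h) *
        gammaMod p ((((2 * m : ℕ) : ZMod (p ^ 2)) + (p : ZMod (p ^ 2)) * t + 1) * h)))
    ?_ ?_ ?_ t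
  · have h1 := (isAffineMod_gammaMod hp (-((2 * m : ℕ) : ZMod (p ^ 2)) * h)).comp_add_mul 0 (-h)
    have h2 := (isAffineMod_gammaMod hp ((((2 * m : ℕ) : ZMod (p ^ 2)) + 1) * h)).comp_add_mul 0 h
    convert (IsAffineMod.const _).mul hπ (h1.mul hπ h2) using 5 <;> ring_nf
  · simpa only [mul_zero, add_zero] using heven m hm
  · obtain ⟨q, hq⟩ := hpp.odd_of_ne_two hp
    have hr : ((2 * m : ℕ) : ZMod (p ^ 2)) + p * (-1) = -1 - ((2 * (q - m) : ℕ) : ZMod (p ^ 2)) := by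
      have := congrArg (Nat.cast : ℕ → ZMod (p ^ 2))
        (show p = 2 * m + 2 * (q - m) + 1 by omega)
      rw [Nat.cast_add, Nat.cast_add] at this
      push_cast at this ⊢
      linear_combination -this
    rw [hr, legendreSum_reflect, heven (q - m) (by omega)]
    ring_nf

theorem theorem1 (p : ℕ) [Fact p.Prime] (hp : 5 ≤ p) (a : ℤ_[p]) (ha : Even a.zmodRepr) :
    ∃ c : ℤ_[p],
      truncHyp [-(a : ℚ_[p]), (a : ℚ_[p]) + 1] [1] (1 / 2) (p - 1) -
        (((-1) ^ ((p + 1) / 2) * padicGamma p (padicHalf p 1) *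
          padicGamma p (padicHalf p (-a)) * padicGamma p (padicHalf p (a + 1)) : ℤ_[p]) :
            ℚ_[p]) =
      (p : ℚ_[p]) ^ 2 * (c : ℚ_[p]) := by
  have hpp : p.Prime := Fact.out
  have hp2 : p ≠ 2 := by omega
  set u : ℕ → ℤ_[p] := fun k => Ring.inverse (k.factorial : ℤ_[p])
  have hu : ∀ k < p, (k.factorial : ℤ_[p]) * u k = 1 := by
    intro k hk
    refine Ring.mul_inverse_cancel _ (PadicInt.isUnit_iff.2 ?_)
    exact PadicInt.norm_natCast_eq_one_iff.2 (hpp.coprime_factorial_of_lt hk)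
  have hh : 2 * padicHalf p 1 = 1 := two_mul_padicHalf p hp2 1
  have hhalf : ∀ x : ℤ_[p], padicHalf p x = x * padicHalf p 1 := by
    intro x; simp [padicHalf]
  -- The truncated series is a `p`-adic integer.
  have hint : truncHyp [-(a : ℚ_[p]), (a : ℚ_[p]) + 1] [1] (1 / 2) (p - 1) =
      (legendreSum p u (padicHalf p 1) a : ℤ_[p]) := by
    have hh' : (1 / 2 : ℚ_[p]) = (padicHalf p 1 : ℤ_[p]) := by
      have := congrArg (PadicInt.Coe.ringHom (p := p)) hh
      rw [map_mul, map_one, map_ofNat] at this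
      change 2 * ((padicHalf p 1 : ℤ_[p]) : ℚ_[p]) = 1 at this
      rw [div_eq_iff two_ne_zero]
      linear_combination -this
    have hasc : ∀ (k : ℕ) (x : ℤ_[p]), (ascPochhammer ℚ_[p] k).eval (x : ℚ_[p]) =
        ((ascPochhammer ℤ_[p] k).eval x : ℤ_[p]) := by
      intro k x
      rw [← ascPochhammer_map (PadicInt.Coe.ringHom (p := p)), Polynomial.eval_map]
      exact Polynomial.eval₂_at_apply (PadicInt.Coe.ringHom (p := p)) x
    have hcast : ∀ (f : ℕ → ℤ_[p]), ((∑ k ∈ Finset.range p, f k : ℤ_[p]) : ℚ_[p]) =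
        ∑ k ∈ Finset.range p, (f k : ℚ_[p]) := fun f =>
      map_sum (PadicInt.Coe.ringHom (p := p)) f _
    rw [truncHyp, legendreSum, Nat.sub_add_cancel hpp.one_le, hcast]
    refine Finset.sum_congr rfl fun k hk => ?_
    have hk0 : (k.factorial : ℚ_[p]) ≠ 0 := by exact_mod_cast k.factorial_ne_zero
    have huk : (u k : ℚ_[p]) = (k.factorial : ℚ_[p])⁻¹ := by
      have := congrArg (fun z : ℤ_[p] => (z : ℚ_[p])) (hu k (Finset.mem_range.1 hk))
      push_cast at this
      exact eq_inv_of_mul_eq_one_right this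
    have h1 := hasc k (-a)
    have h2 := hasc k (a + 1)
    push_cast at h1 h2 ⊢
    rw [huk, ← h1, ← h2, ← hh']
    simp only [List.map_cons, List.map_nil, List.prod_cons, List.prod_nil, mul_one,
      ascPochhammer_eval_one]
    field_simp
  -- Write `a = 2m + p t`.
  obtain ⟨m, hm⟩ := ha
  obtain ⟨t, ht⟩ : (p : ℤ_[p]) ∣ a - a.zmodRepr := by
    have := a.sub_zmodRepr_mem
    rwa [PadicInt.maximalIdeal_eq_span_p, Ideal.mem_span_singleton] at this
  have hm2 : a.zmodRepr = 2 * m := by omega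
  have hmp : 2 * m < p := hm2 ▸ a.zmodRepr_lt_p
  have ha : PadicInt.toZModPow 2 a =
      ((2 * m : ℕ) : ZMod (p ^ 2)) + (p : ZMod (p ^ 2)) * PadicInt.toZModPow 2 t := by
    rw [eq_add_of_sub_eq' ht, hm2, map_add, map_mul, map_natCast, map_natCast]
  have hmap : PadicInt.toZModPow 2 (legendreSum p u (padicHalf p 1) a) =
      legendreSum p (fun k => PadicInt.toZModPow 2 (u k)) (PadicInt.toZModPow 2 (padicHalf p 1))
        (PadicInt.toZModPow 2 a) := by
    have hasc : ∀ (k : ℕ) (x : ℤ_[p]), PadicInt.toZModPow 2 ((ascPochhammer ℤ_[p] k).eval x) =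
        (ascPochhammer (ZMod (p ^ 2)) k).eval (PadicInt.toZModPow 2 x) := by
      intro k x
      rw [← ascPochhammer_map (PadicInt.toZModPow (p := p) 2), Polynomial.eval_map]
      exact (Polynomial.eval₂_at_apply (PadicInt.toZModPow (p := p) 2) x).symm
    simp only [legendreSum, map_sum, map_mul, map_pow, hasc, map_neg, map_add, map_one]
  have hmem : legendreSum p u (padicHalf p 1) a -
      ((-1) ^ ((p + 1) / 2) * padicGamma p (padicHalf p 1) *
        padicGamma p (padicHalf p (-a)) * padicGamma p (padicHalf p (a + 1))) ∈
      RingHom.ker (PadicInt.toZModPow (p := p) 2) := by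
    have hu' : ∀ k < p, (k.factorial : ZMod (p ^ 2)) * PadicInt.toZModPow 2 (u k) = 1 := by
      intro k hk
      rw [← map_natCast (PadicInt.toZModPow (p := p) 2), ← map_mul, hu k hk, map_one]
    have hh' : 2 * PadicInt.toZModPow (p := p) 2 (padicHalf p 1) = 1 := by
      rw [← map_ofNat (PadicInt.toZModPow (p := p) 2) 2, ← map_mul, hh, map_one]
    rw [RingHom.mem_ker, map_sub, hmap, ha, legendreSum_eq_gammaMod hp2 hu' hh' hmp, ← ha,
      hhalf (-a), hhalf (a + 1)]
    simp only [map_mul, map_pow, map_neg, map_one, map_add, toZModPow_padicGamma hp2]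
    ring
  rw [PadicInt.ker_toZModPow, Ideal.mem_span_singleton] at hmem
  obtain ⟨c, hc⟩ := hmem
  refine ⟨c, ?_⟩
  rw [hint]
  exact_mod_cast congrArg (fun z : ℤ_[p] => (z : ℚ_[p])) hc
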